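/- \textbf{Setting.} Let $p,q\ge 0$ be integers and let $(\Sigma_i)_{i\in I}$ be a family of continuous-time linear agents \[ \dot x_i=A_ix_i+B_iu_i,\qquad y_i=C_ix_i,\qquad y_{i,m}=C_{i,m}x_i , \] with real matrices, $x_i\in\mathbb{R}^{n_i}$, $u_i\in\mathbb{R}^{m_i}$, $y_i\in\mathbb{R}^p$, $y_{i,m}\in\mathbb{R}^{r_i}$ (only $p$ is common to all agents). Each agent $i\in I$ is equipped with a linear protocol \[ \dot\xi_i=K_i\xi_i+L_i\zeta_i+L_{i,e}\hat\zeta_i+L_{i,m}y_{i,m},\qquad u_i=M_i\xi_i,\qquad \eta_i=N_i\xi_i , \] with $\xi_i\in\mathbb{R}^{s_i}$ and $\eta_i\in\mathbb{R}^{q}$ (the matrices $L_{i,e}$ and $L_{i,m}$ may be zero). A \emph{weighted graph} on $M$ nodes is a matrix $[a_{kl}]\in\mathbb{R}^{M\times M}$ with $a_{kl}\ge 0$ and $a_{kk}=0$; there is an edge from node $l$ to node $k$ if and only if $a_{kl}>0$. It \emph{has a directed spanning tree} if there are a node (the root) and a set of edges of the graph such that, with respect to these edges, the root has no parent, every other node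 has exactly one parent, and the root has a directed path to every node. Given a selection of finitely many pairwise distinct agents $\tau_1,\dots,\tau_M\in I$ and a weighted graph on $M$ nodes, the \emph{network} is the interconnection of these agents and their protocols through \[ \zeta_{\tau_k}=\sum_{l=1}^M a_{kl}(y_{\tau_k}-y_{\tau_l}),\qquad \hat\zeta_{\tau_k}=\sum_{l=1}^M a_{kl}(\eta_{\tau_k}-\eta_{\tau_l}),\qquad k=1,\dots,M . \] The network achieves \emph{output synchronization} if $y_{\tau_k}(t)-y_{\tau_l}(t)\to 0$ as $t\to\infty$ for all $k,l$ and all initial conditions; it achieves \emph{weak synchronization} if $\zeta_{\tau_k}(t)\to 0$ as $t\to\infty$ for all $k$ and all initial conditions. The family of protocols achieves \emph{scale-free output synchronization} for the family of agents if, for every selection of finitely many pairwise distinct agents and every weighted graph on them that has a directed spanning tree, the network achieves output synchronization. It achieves \emph{scale-free weak synchronization} if, for every selection of finitely many pairwise distinct agents and every weighted graph on them, the network achieves weak synchronization. \textbf{Theorem.} For every such family of agents and family of protocols, the family of protocols achieves scale-free output synchronization if and only if it achieves scale-free weak synchronization. -/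

import Mathlib

open Filter Topology Matrix

namespace MAS

/-- A weighted directed graph on the nodes `Fin M`: a nonnegative adjacency matrix without
self-loops. The entry `a i j` is the weight of the edge from node `j` to node `i`. -/
structure WeightedGraph (M : ℕ) where
  a : Matrix (Fin M) (Fin M) ℝ
  nonneg : ∀ i j, 0 ≤ a i j
  no_loops : ∀ i, a i i = 0

namespace WeightedGraph

variable {M : ℕ}

/-- There is an edge from `j` to `i` exactly when `a i j > 0`. -/
def Edge (G : WeightedGraph M) (j i : Fin M) : Prop := 0 < G.a i j

/-- The edge set `T` (`T j i`: an edge from the parent `j` to `i`) is a directed spanning tree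
of `G` with root `r`: its edges are edges of `G`, the root has no parent, every other node has
exactly one parent, and the root has a directed path in `T` to every node. -/
structure IsDirectedSpanningTree (G : WeightedGraph M) (T : Fin M → Fin M → Prop)
    (r : Fin M) : Prop where
  subgraph : ∀ j i, T j i → G.Edge j i
  root_no_parent : ∀ j, ¬ T j r
  unique_parent : ∀ i, i ≠ r → ∃! j, T j i
  reaches : ∀ i, Relation.ReflTransGen T r i

/-- `G` has a directed spanning tree. -/
def HasDirectedSpanningTree (G : WeightedGraph M) : Prop :=
  ∃ (T : Fin M → Fin M → Prop) (r : Fin M), G.IsDirectedSpanningTree T r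

end WeightedGraph

/-- The data of a linear agent `x' = A x + B u`, `y = C x`, with the additional local
measurement `y_m = C_m x`. All agents share the output dimension `p`; the dimensions `n`, `m`, `r`
of the state, the input and the local measurement are those of the agent. -/
structure Agent (p : ℕ) where
  n : ℕ
  m : ℕ
  r : ℕ
  A : Matrix (Fin n) (Fin n) ℝ
  B : Matrix (Fin n) (Fin m) ℝ
  C : Matrix (Fin p) (Fin n) ℝ
  Cm : Matrix (Fin r) (Fin n) ℝ

/-- The data of a linear protocol for a given agent,
`ξ' = K ξ + L ζ + L_e ζ̂ + L_m y_m`, `u = M ξ`, `η = N ξ`, where `s` is the dimension of `ξ`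
and `q` (common to all agents) that of the exchanged variable `η`. A non-introspective agent has
`Lm = 0`; an agent without the extra communication has `Le = 0`. -/
structure Protocol {p : ℕ} (ag : Agent p) (q : ℕ) where
  s : ℕ
  K : Matrix (Fin s) (Fin s) ℝ
  L : Matrix (Fin s) (Fin p) ℝ
  Le : Matrix (Fin s) (Fin q) ℝ
  Lm : Matrix (Fin s) (Fin ag.r) ℝ
  M : Matrix (Fin ag.m) (Fin s) ℝ
  N : Matrix (Fin q) (Fin s) ℝ

section Network

variable {p q M : ℕ}

/-- The signal `∑ⱼ aᵢⱼ (vᵢ - vⱼ)` that agent `i` receives over the network when the agents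
send `v`. -/
def networkSignal {d : ℕ} (G : WeightedGraph M) (v : Fin M → Fin d → ℝ) (i : Fin M) :
    Fin d → ℝ :=
  ∑ j, G.a i j • (v i - v j)

/-- The outputs `yᵢ = Cᵢ xᵢ` at time `t`. -/
def output (ag : Fin M → Agent p) (x : ∀ i, ℝ → Fin (ag i).n → ℝ) (t : ℝ) (i : Fin M) :
    Fin p → ℝ :=
  (ag i).C *ᵥ x i t

/-- The signals `ηᵢ = Nᵢ ξᵢ` at time `t`. -/
def protocolOutput {ag : Fin M → Agent p} (pr : ∀ i, Protocol (ag i) q)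
    (ξ : ∀ i, ℝ → Fin (pr i).s → ℝ) (t : ℝ) (i : Fin M) : Fin q → ℝ :=
  (pr i).N *ᵥ ξ i t

/-- `(x, ξ)` is a trajectory of the continuous-time closed loop of the agents and their protocols
over `G`, where `ζᵢ = ∑ⱼ aᵢⱼ (yᵢ - yⱼ)`, `ζ̂ᵢ = ∑ⱼ aᵢⱼ (ηᵢ - ηⱼ)`, `uᵢ = Mᵢ ξᵢ` and
`y_{i,m} = C_{i,m} xᵢ`. -/
structure IsTrajectory (ag : Fin M → Agent p) (pr : ∀ i, Protocol (ag i) q)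
    (G : WeightedGraph M) (x : ∀ i, ℝ → Fin (ag i).n → ℝ)
    (ξ : ∀ i, ℝ → Fin (pr i).s → ℝ) : Prop where
  agent_dynamics : ∀ i t,
    HasDerivAt (x i) ((ag i).A *ᵥ x i t + (ag i).B *ᵥ ((pr i).M *ᵥ ξ i t)) t
  protocol_dynamics : ∀ i t,
    HasDerivAt (ξ i)
      ((pr i).K *ᵥ ξ i t + (pr i).L *ᵥ networkSignal G (output ag x t) i
        + (pr i).Le *ᵥ networkSignal G (protocolOutput pr ξ t) i
        + (pr i).Lm *ᵥ ((ag i).Cm *ᵥ x i t)) t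

/-- Output synchronization: `yᵢ(t) - yⱼ(t) → 0` for all `i`, `j` and all initial conditions. -/
def OutputSynchronization (ag : Fin M → Agent p) (pr : ∀ i, Protocol (ag i) q)
    (G : WeightedGraph M) : Prop :=
  ∀ (x : ∀ i, ℝ → Fin (ag i).n → ℝ) (ξ : ∀ i, ℝ → Fin (pr i).s → ℝ),
    IsTrajectory ag pr G x ξ → ∀ i j : Fin M,
      Tendsto (fun t => output ag x t i - output ag x t j) atTop (𝓝 0)

/-- Weak synchronization (network stability): `ζᵢ(t) → 0` for all `i` and all initial
conditions. -/
def WeakSynchronization (ag : Fin M → Agent p) (pr : ∀ i, Protocol (ag i) q)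
    (G : WeightedGraph M) : Prop :=
  ∀ (x : ∀ i, ℝ → Fin (ag i).n → ℝ) (ξ : ∀ i, ℝ → Fin (pr i).s → ℝ),
    IsTrajectory ag pr G x ξ → ∀ i : Fin M,
      Tendsto (fun t => networkSignal G (output ag x t) i) atTop (𝓝 0)

end Network

/-- Scale-free output synchronization: output synchronization for every selection of finitely many
agents of the family and every graph on them that has a directed spanning tree. -/
def ScaleFreeOutputSynchronization {ι : Type*} {p q : ℕ} (ag : ι → Agent p)
    (pr : ∀ i, Protocol (ag i) q) : Prop :=
  ∀ (M : ℕ) (τ : Fin M ↪ ι) (G : WeightedGraph M), G.HasDirectedSpanningTree →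
    OutputSynchronization (fun k => ag (τ k)) (fun k => pr (τ k)) G

/-- Scale-free weak synchronization: weak synchronization for every selection of finitely many
agents of the family and every graph on them. -/
def ScaleFreeWeakSynchronization {ι : Type*} {p q : ℕ} (ag : ι → Agent p)
    (pr : ∀ i, Protocol (ag i) q) : Prop :=
  ∀ (M : ℕ) (τ : Fin M ↪ ι) (G : WeightedGraph M),
    WeakSynchronization (fun k => ag (τ k)) (fun k => pr (τ k)) G

end MAS

/-!
Over a graph with a directed spanning tree with root `r`, the two kinds of synchronization are
equivalent. Output synchronization trivially makes every signal `∑ⱼ aᵢⱼ (yᵢ - yⱼ)` tend to zero.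
Conversely, by the maximum principle (`le_of_laplacian_eq_zero`) the Laplacian is injective on
functions vanishing at `r`, so that `y - y r` is a continuous function of the signals
(`WeakSynchronization.outputSynchronization`).

It remains to obtain weak synchronization over an arbitrary graph `G` from output synchronization
over the graphs with a spanning tree. By linearity, a trajectory is the sum of trajectories whose
initial states are supported at one node `i`, and such a trajectory vanishes at all nodes that
cannot be reached from `i`. Choose an ancestor `r` of `i` in a source component of `G`; the
trajectory then vanishes off the set `S` of nodes reached from `r`. The nodes of `S` may still
have parents outside `S`, so the closed loop does not restrict to a network on `S`: the missing
parents act as grounded neighbours.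

This is repaired by a Doob transform. There is a function `h` that is positive on `S`, zero off
`S` and harmonic at the nodes of `S` (`exists_harmonic_of_source`). Since the dynamics of each
agent and its protocol are linear, the scaled states `xₖ / h(k)`, `ξₖ / h(k)` obey the same agent
and protocol equations, and harmonicity of `h` says precisely that their coupling is that of the
graph on `S` with weights `aₖₗ h(l) / h(k)`, with no grounding left
(`networkSignal_doobTransform`). In this graph `r` reaches every node, so it has a directed
spanning tree, the scaled outputs synchronize, and the signals of the trajectory tend to zero
(`tendsto_networkSignal_of_source`).
-/

namespace MAS

namespace WeightedGraph

variable {M : ℕ} (G : WeightedGraph M)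

/-- `G.Reaches j i`: there is a directed path from `j` to `i`, possibly of length zero. -/
def Reaches (j i : Fin M) : Prop := Relation.ReflTransGen G.Edge j i

/-- The Laplacian of `G` applied to a scalar function on the nodes. -/
def laplacian (h : Fin M → ℝ) (i : Fin M) : ℝ := ∑ j, G.a i j * (h i - h j)

variable {G}

/-! ### Reachability and spanning trees -/

/-- Choosing for each node other than `r` a parent that is closer to `r` yields a directed spanning
tree. -/
theorem hasDirectedSpanningTree_of_reaches {r : Fin M} (hr : ∀ i, G.Reaches r i) :
    G.HasDirectedSpanningTree := by
  classical
  -- `W n i`: there is a walk of length exactly `n` from `r` to `i`.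
  let W : ℕ → Fin M → Prop := fun n =>
    Nat.rec (motive := fun _ => Fin M → Prop) (fun i => i = r) (fun _ P i => ∃ j, P j ∧ G.Edge j i) n
  have hW : ∀ i, ∃ n, W n i := by
    intro i
    induction hr i with
    | refl => exact ⟨0, rfl⟩
    | tail _ e ih =>
      obtain ⟨n, hn⟩ := ih
      exact ⟨n + 1, _, hn, e⟩
  have hmin : ∀ i, ∃ n, W n i ∧ ∀ m, W m i → n ≤ m := fun i =>
    ⟨Nat.find (hW i), Nat.find_spec (hW i),
      fun m hm => Nat.find_min' (hW i) hm⟩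
  choose d hd hd_le using hmin
  have hpar : ∀ i, ∃ j, i ≠ r → G.Edge j i ∧ d j < d i := by
    intro i
    by_cases hi : i = r
    · exact ⟨i, fun h => absurd hi h⟩
    have hspec := hd i
    rcases hdi : d i with _ | n
    · rw [hdi] at hspec
      exact absurd hspec hi
    · rw [hdi] at hspec
      obtain ⟨j, hj, e⟩ := hspec
      exact ⟨j, fun _ => ⟨e, Nat.lt_succ_of_le (hd_le j n hj)⟩⟩
  choose par hpar using hpar
  refine ⟨fun j i => i ≠ r ∧ j = par i, r, ?_, ?_, ?_, ?_⟩
  · rintro j i ⟨hi, rfl⟩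
    exact (hpar i hi).1
  · exact fun j h => h.1 rfl
  · exact fun i hi => ⟨par i, ⟨hi, rfl⟩, fun j h => h.2⟩
  · intro i
    induction hn : d i using Nat.strong_induction_on generalizing i with
    | _ n ih =>
      by_cases hi : i = r
      · rw [hi]
      · exact (ih _ (hn ▸ (hpar i hi).2) _ rfl).tail ⟨hi, rfl⟩

/-- Every node has an ancestor in a source component of the condensation of the graph. -/
theorem exists_source_reaches (i : Fin M) :
    ∃ r, G.Reaches r i ∧ ∀ k, G.Reaches k r → G.Reaches r k := by
  classical
  let anc : Fin M → Finset (Fin M) := fun j => Finset.univ.filter fun k => G.Reaches k j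
  have hanc : ∀ j k, k ∈ anc j ↔ G.Reaches k j := fun j k => by simp [anc]
  -- An ancestor with the fewest ancestors is reached by no node that it does not reach.
  obtain ⟨r, hri, hmin⟩ := Finset.exists_min_image (anc i) (fun j => (anc j).card)
    ⟨i, (hanc i i).2 Relation.ReflTransGen.refl⟩
  rw [hanc] at hri
  refine ⟨r, hri, fun k hk => ?_⟩
  have hsub : anc k ⊆ anc r := fun l hl =>
    (hanc r l).2 (Relation.ReflTransGen.trans ((hanc k l).1 hl) hk)
  have heq := Finset.eq_of_subset_of_card_le hsub
    (hmin k ((hanc i k).2 (Relation.ReflTransGen.trans hk hri)))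
  rw [← hanc, heq, hanc]
  exact Relation.ReflTransGen.refl

/-! ### The Dirichlet problem on a weighted graph -/

/-- Maximum principle: a function that is harmonic off `B` is bounded by its values on `B`,
because a maximum propagates backwards along edges until `B` is met. -/
theorem le_of_laplacian_eq_zero {B : Set (Fin M)} (hB : ∀ i, ∃ b ∈ B, G.Reaches b i)
    {h : Fin M → ℝ} (hh : ∀ i ∉ B, G.laplacian h i = 0) {c : ℝ} (hc : ∀ b ∈ B, h b ≤ c)
    (i : Fin M) : h i ≤ c := by
  have : Nonempty (Fin M) := ⟨i⟩
  obtain ⟨m, hm⟩ := Finite.exists_max h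
  obtain ⟨b, hb, hbm⟩ := hB m
  have key : h b = h m ∨ ∃ b' ∈ B, h b' = h m := by
    refine Relation.ReflTransGen.head_induction_on
      (motive := fun k _ => h k = h m ∨ ∃ b' ∈ B, h b' = h m) hbm (Or.inl rfl) ?_
    intro k l hkl _ ih
    rcases ih with ih | ih
    · by_cases hl : l ∈ B
      · exact Or.inr ⟨l, hl, ih⟩
      · have h0 := (Finset.sum_eq_zero_iff_of_nonneg (fun j _ =>
          mul_nonneg (G.nonneg l j) (sub_nonneg.2 (ih ▸ hm j)))).1 (hh l hl) k (Finset.mem_univ k)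
        have hpos : G.a l k ≠ 0 := ne_of_gt hkl
        rcases mul_eq_zero.1 h0 with h0 | h0
        · exact absurd h0 hpos
        · exact Or.inl (by linarith)
    · exact Or.inr ih
  have hmc : h m ≤ c := by
    rcases key with h' | ⟨b', hb', h'⟩
    · exact h' ▸ hc b hb
    · exact h' ▸ hc b' hb'
  exact (hm i).trans hmc

theorem laplacian_neg (h : Fin M → ℝ) (i : Fin M) : G.laplacian (-h) i = -G.laplacian h i := by
  simp only [laplacian, Pi.neg_apply, ← Finset.sum_neg_distrib]
  exact Finset.sum_congr rfl fun j _ => by ring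

theorem ge_of_laplacian_eq_zero {B : Set (Fin M)} (hB : ∀ i, ∃ b ∈ B, G.Reaches b i)
    {h : Fin M → ℝ} (hh : ∀ i ∉ B, G.laplacian h i = 0) {c : ℝ} (hc : ∀ b ∈ B, c ≤ h b)
    (i : Fin M) : c ≤ h i := by
  have := le_of_laplacian_eq_zero hB (h := -h) (c := -c)
    (fun i hi => by rw [laplacian_neg, hh i hi, neg_zero])
    (fun b hb => neg_le_neg (hc b hb)) i
  simpa using this

open Classical in
/-- The operator of the Dirichlet problem with boundary `B`: the Laplacian off `B` and the
identity on `B`. -/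
noncomputable def dirichlet (G : WeightedGraph M) (B : Set (Fin M)) :
    (Fin M → ℝ) →ₗ[ℝ] (Fin M → ℝ) where
  toFun h i := if i ∈ B then h i else G.laplacian h i
  map_add' h h' := by
    ext i
    by_cases hi : i ∈ B
    · simp [hi]
    · simp only [hi, if_false, laplacian, Pi.add_apply, ← Finset.sum_add_distrib]
      exact Finset.sum_congr rfl fun j _ => by ring
  map_smul' c h := by
    ext i
    by_cases hi : i ∈ B
    · simp [hi]
    · simp only [hi, if_false, laplacian, Pi.smul_apply, smul_eq_mul, RingHom.id_apply,
        Finset.mul_sum]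
      exact Finset.sum_congr rfl fun j _ => by ring

theorem dirichlet_apply_of_mem {B : Set (Fin M)} {i : Fin M} (hi : i ∈ B) (h : Fin M → ℝ) :
    G.dirichlet B h i = h i := if_pos hi

theorem dirichlet_apply_of_notMem {B : Set (Fin M)} {i : Fin M} (hi : i ∉ B) (h : Fin M → ℝ) :
    G.dirichlet B h i = G.laplacian h i := if_neg hi

theorem dirichlet_injective {B : Set (Fin M)} (hB : ∀ i, ∃ b ∈ B, G.Reaches b i) :
    Function.Injective (G.dirichlet B) := by
  refine (injective_iff_map_eq_zero _).2 fun h h0 => ?_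
  have hin : ∀ b ∈ B, h b = 0 := fun b hb => by
    rw [← dirichlet_apply_of_mem (G := G) hb h, h0, Pi.zero_apply]
  have hout : ∀ i ∉ B, G.laplacian h i = 0 := fun i hi => by
    rw [← dirichlet_apply_of_notMem hi h, h0, Pi.zero_apply]
  ext i
  exact le_antisymm (le_of_laplacian_eq_zero hB hout (fun b hb => (hin b hb).le) i)
    (ge_of_laplacian_eq_zero hB hout (fun b hb => (hin b hb).ge) i)

/-- If `r` lies in a source component, there is a function that is positive on the nodes reached
from `r`, vanishes on all others, and is harmonic at the nodes reached from `r`. It is the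
probability that the random walk against the edges ends in the component of `r`. -/
theorem exists_harmonic_of_source {r : Fin M} (hr : ∀ k, G.Reaches k r → G.Reaches r k) :
    ∃ h : Fin M → ℝ, (∀ i, G.Reaches r i → 0 < h i) ∧ (∀ i, ¬ G.Reaches r i → h i = 0) ∧
      ∀ i, G.Reaches r i → G.laplacian h i = 0 := by
  classical
  -- `R` is the component of `r`. The values prescribed on `B` are `1` on `R` and `0` at the nodes
  -- not reached from `r`.
  let R : Set (Fin M) := {i | G.Reaches i r}
  let B : Set (Fin M) := {i | G.Reaches i r ∨ ¬ G.Reaches r i}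
  have hrr : G.Reaches r r := Relation.ReflTransGen.refl
  have hB : ∀ i, ∃ b ∈ B, G.Reaches b i := fun i => by
    by_cases hi : G.Reaches r i
    · exact ⟨r, Or.inl hrr, hi⟩
    · exact ⟨i, Or.inr hi, Relation.ReflTransGen.refl⟩
  obtain ⟨h, hh⟩ := (LinearMap.injective_iff_surjective.1 (dirichlet_injective hB))
    (fun i => if i ∈ R then 1 else 0)
  have hR : ∀ i, G.Reaches i r → h i = 1 := fun i hi => by
    rw [← dirichlet_apply_of_mem (G := G) (B := B) (Or.inl hi) h, hh]
    exact if_pos hi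
  have hS : ∀ i, ¬ G.Reaches r i → h i = 0 := fun i hi => by
    rw [← dirichlet_apply_of_mem (G := G) (B := B) (Or.inr hi) h, hh]
    exact if_neg fun h' => hi (hr i h')
  have hout : ∀ i ∉ B, G.laplacian h i = 0 := fun i hi => by
    rw [← dirichlet_apply_of_notMem hi h, hh]
    exact if_neg fun h' => hi (Or.inl h')
  have hharm : ∀ i, G.Reaches r i → G.laplacian h i = 0 := by
    intro i hi
    by_cases hiB : i ∈ B
    · have hir : G.Reaches i r := hiB.resolve_right (not_not.2 hi)
      -- All edges into the component of `r` start in that component, where `h` is constant.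
      refine Finset.sum_eq_zero fun j _ => ?_
      rcases (G.nonneg i j).eq_or_lt with h0 | hpos
      · rw [← h0, zero_mul]
      · rw [hR i hir, hR j (Relation.ReflTransGen.head hpos hir), sub_self, mul_zero]
    · exact hout i hiB
  have hnonneg : ∀ i, 0 ≤ h i := by
    refine ge_of_laplacian_eq_zero hB hout fun b hb => ?_
    rcases hb with hb | hb
    · rw [hR b hb]
      exact zero_le_one
    · rw [hS b hb]
  refine ⟨h, fun i hi => ?_, hS, hharm⟩
  induction hi with
  | refl => rw [hR r hrr]; exact zero_lt_one
  | @tail b c hb e ih =>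
    refine (hnonneg c).lt_of_ne fun h0 => ?_
    have hsum := hharm c (Relation.ReflTransGen.tail hb e)
    rw [laplacian, Finset.sum_eq_zero_iff_of_nonpos (fun j _ =>
      mul_nonpos_of_nonneg_of_nonpos (G.nonneg c j) (by linarith [hnonneg j]))] at hsum
    have hb0 := hsum b (Finset.mem_univ b)
    have hpos : 0 < G.a c b * h b := mul_pos e ih
    rw [← h0] at hb0
    linarith

/-! ### Doob transforms -/

/-- The Doob transform of `G` by `h`, restricted to the nodes selected by `σ`: the weights
`aₖₗ h(l) / h(k)`. -/
noncomputable def doobTransform {m : ℕ} (G : WeightedGraph M) (σ : Fin m ↪ Fin M)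
    (h : Fin M → ℝ) (hpos : ∀ k, 0 < h (σ k)) : WeightedGraph m where
  a := Matrix.of fun k l => G.a (σ k) (σ l) * h (σ l) / h (σ k)
  nonneg k l := div_nonneg (mul_nonneg (G.nonneg _ _) (hpos l).le) (hpos k).le
  no_loops k := by simp [G.no_loops]

theorem doobTransform_hasDirectedSpanningTree {m : ℕ} {σ : Fin m ↪ Fin M} {h : Fin M → ℝ}
    (hpos : ∀ k, 0 < h (σ k)) {r : Fin M} (hσ : ∀ i, G.Reaches r i ↔ i ∈ Set.range σ) :
    (G.doobTransform σ h hpos).HasDirectedSpanningTree := by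
  obtain ⟨k₀, hk₀⟩ := (hσ r).1 Relation.ReflTransGen.refl
  have key : ∀ i, G.Reaches r i → ∀ k, σ k = i → (G.doobTransform σ h hpos).Reaches k₀ k := by
    intro i hi
    induction hi with
    | refl =>
      intro k hk
      rw [σ.injective (hk.trans hk₀.symm)]
      exact Relation.ReflTransGen.refl
    | @tail b c hb e ih =>
      intro k hk
      obtain ⟨l, hl⟩ := (hσ b).1 hb
      refine Relation.ReflTransGen.tail (ih l hl) ?_
      have e' : 0 < G.a (σ k) (σ l) := by rw [hk, hl]; exact e
      exact div_pos (mul_pos e' (hpos l)) (hpos k)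
  exact hasDirectedSpanningTree_of_reaches (r := k₀) fun k =>
    key (σ k) ((hσ _).2 ⟨k, rfl⟩) k rfl

end WeightedGraph

open WeightedGraph

/-! ### Network signals -/

section Signals

variable {M d : ℕ}

theorem networkSignal_apply (G : WeightedGraph M) (v : Fin M → Fin d → ℝ) (i : Fin M)
    (c : Fin d) : networkSignal G v i c = G.laplacian (fun k => v k c) i := by
  simp [networkSignal, laplacian, Finset.sum_apply]

theorem networkSignal_add (G : WeightedGraph M) (v w : Fin M → Fin d → ℝ) (i : Fin M) :
    networkSignal G (fun k => v k + w k) i = networkSignal G v i + networkSignal G w i := by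
  simp only [networkSignal, ← Finset.sum_add_distrib, ← smul_add]
  exact Finset.sum_congr rfl fun j _ => by congr 1; abel

theorem networkSignal_smul (G : WeightedGraph M) (c : ℝ) (v : Fin M → Fin d → ℝ) (i : Fin M) :
    networkSignal G (fun k => c • v k) i = c • networkSignal G v i := by
  simp only [networkSignal, Finset.smul_sum, ← smul_sub]
  exact Finset.sum_congr rfl fun j _ => smul_comm _ _ _

/-- Division by `h` turns signals that vanish off the selected nodes into signals over the Doob
transform. -/
theorem networkSignal_doobTransform {m : ℕ} {G : WeightedGraph M} {σ : Fin m ↪ Fin M}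
    {h : Fin M → ℝ} (hpos : ∀ k, 0 < h (σ k)) (hzero : ∀ i ∉ Set.range σ, h i = 0)
    (hharm : ∀ k, G.laplacian h (σ k) = 0) {v : Fin M → Fin d → ℝ}
    (hv : ∀ i ∉ Set.range σ, v i = 0) (k : Fin m) :
    networkSignal (G.doobTransform σ h hpos) (fun l => (h (σ l))⁻¹ • v (σ l)) k
      = (h (σ k))⁻¹ • networkSignal G v (σ k) := by
  ext c
  have hk := (hpos k).ne'
  rw [Pi.smul_apply, networkSignal_apply, networkSignal_apply, laplacian, laplacian]
  rw [Fintype.sum_of_injective σ σ.injective _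
    (fun j => (h (σ k))⁻¹ * (G.a (σ k) j * (h j * (v (σ k) c / h (σ k)) - v j c)))
    (fun j hj => by simp [hzero j hj, hv j hj])
    (fun l => by
      have hl := (hpos l).ne'
      simp only [doobTransform, Matrix.of_apply, Pi.smul_apply, smul_eq_mul]
      field_simp)]
  rw [smul_eq_mul, ← Finset.mul_sum]
  congr 1
  have := congrArg (fun s => s * (v (σ k) c / h (σ k))) (hharm k)
  simp only [laplacian, zero_mul, Finset.sum_mul] at this
  rw [← sub_eq_zero, ← Finset.sum_sub_distrib, ← neg_eq_zero, ← Finset.sum_neg_distrib, ← this]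
  refine Finset.sum_congr rfl fun j _ => ?_
  field_simp
  ring

end Signals

/-! ### Linear differential equations -/

section LinearODE

variable {E : Type*} [NormedAddCommGroup E] [NormedSpace ℝ E] [FiniteDimensional ℝ E]

theorem exists_hasDerivAt_linear (f : E →ₗ[ℝ] E) (v : E) :
    ∃ z : ℝ → E, z 0 = v ∧ ∀ t, HasDerivAt z (f (z t)) t := by
  have : CompleteSpace E := FiniteDimensional.complete ℝ E
  let A : E →L[ℝ] E := LinearMap.toContinuousLinearMap f
  refine ⟨fun t => NormedSpace.exp (t • A) v, by simp, fun t => ?_⟩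
  exact ((hasDerivAt_exp_smul_const' A t).clm_apply (hasDerivAt_const t v)).congr_deriv (by simp [A])

/-- A linear flow preserves the invariant subspaces of its generator. -/
theorem exists_hasDerivAt_linear_mem (f : E →ₗ[ℝ] E) (V : Submodule ℝ E)
    (hV : ∀ v ∈ V, f v ∈ V) {v : E} (hv : v ∈ V) :
    ∃ z : ℝ → E, z 0 = v ∧ (∀ t, HasDerivAt z (f (z t)) t) ∧ ∀ t, z t ∈ V := by
  obtain ⟨z, hz0, hz⟩ := exists_hasDerivAt_linear (f.restrict hV) ⟨v, hv⟩
  refine ⟨fun t => z t, congrArg Subtype.val hz0, fun t => ?_, fun t => (z t).2⟩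
  exact V.subtypeL.hasFDerivAt.comp_hasDerivAt t (hz t)

theorem hasDerivAt_linear_unique (f : E →ₗ[ℝ] E) {z w : ℝ → E}
    (hz : ∀ t, HasDerivAt z (f (z t)) t) (hw : ∀ t, HasDerivAt w (f (w t)) t)
    (h0 : z 0 = w 0) : z = w :=
  ODE_solution_unique_univ (v := fun _ => f) (s := fun _ => Set.univ) (t₀ := 0)
    (fun _ => (LinearMap.toContinuousLinearMap f).lipschitz.lipschitzOnWith)
    (fun t => ⟨hz t, trivial⟩) (fun t => ⟨hw t, trivial⟩) h0

end LinearODE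

/-! ### The closed loop -/

section ClosedLoop

variable {p q M : ℕ} {ag : Fin M → Agent p} {pr : ∀ i, Protocol (ag i) q}

/-- The generator of the closed loop, acting on the pairs `(xₖ, ξₖ)` of all nodes. -/
def closedLoop (ag : Fin M → Agent p) (pr : ∀ i, Protocol (ag i) q) (G : WeightedGraph M) :
    (∀ k, (Fin (ag k).n → ℝ) × (Fin (pr k).s → ℝ)) →ₗ[ℝ]
      (∀ k, (Fin (ag k).n → ℝ) × (Fin (pr k).s → ℝ)) where
  toFun z k :=
    ((ag k).A *ᵥ (z k).1 + (ag k).B *ᵥ ((pr k).M *ᵥ (z k).2),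
      (pr k).K *ᵥ (z k).2 + (pr k).L *ᵥ networkSignal G (fun j => (ag j).C *ᵥ (z j).1) k
        + (pr k).Le *ᵥ networkSignal G (fun j => (pr j).N *ᵥ (z j).2) k
        + (pr k).Lm *ᵥ ((ag k).Cm *ᵥ (z k).1))
  map_add' z w := by
    ext1 k
    simp only [Pi.add_apply, Prod.fst_add, Prod.snd_add, mulVec_add, networkSignal_add,
      Prod.mk_add_mk]
    congr 1 <;> abel
  map_smul' c z := by
    ext1 k
    simp only [Pi.smul_apply, Prod.smul_fst, Prod.smul_snd, mulVec_smul, networkSignal_smul,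
      RingHom.id_apply, Prod.smul_mk, smul_add]

theorem isTrajectory_iff_hasDerivAt {G : WeightedGraph M}
    {z : ℝ → ∀ k, (Fin (ag k).n → ℝ) × (Fin (pr k).s → ℝ)} :
    IsTrajectory ag pr G (fun k t => (z t k).1) (fun k t => (z t k).2) ↔
      ∀ t, HasDerivAt z (closedLoop ag pr G (z t)) t := by
  constructor
  · intro h t
    exact hasDerivAt_pi.2 fun k => (h.agent_dynamics k t).prodMk (h.protocol_dynamics k t)
  · intro h
    constructor
    · intro k t
      exact (ContinuousLinearMap.fst ℝ _ _).hasFDerivAt.comp_hasDerivAt t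
        (hasDerivAt_pi.1 (h t) k)
    · intro k t
      exact (ContinuousLinearMap.snd ℝ _ _).hasFDerivAt.comp_hasDerivAt t
        (hasDerivAt_pi.1 (h t) k)

theorem networkSignal_eq_zero {d : ℕ} {G : WeightedGraph M} {S : Set (Fin M)}
    (hS : ∀ i ∉ S, ∀ j ∈ S, ¬ G.Edge j i) {v : Fin M → Fin d → ℝ} (hv : ∀ i ∉ S, v i = 0)
    {i : Fin M} (hi : i ∉ S) : networkSignal G v i = 0 := by
  refine Finset.sum_eq_zero fun j _ => ?_
  by_cases hj : j ∈ S
  · rw [le_antisymm (not_lt.1 (hS i hi j hj)) (G.nonneg i j), zero_smul]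
  · rw [hv i hi, hv j hj, sub_zero, smul_zero]

/-- If no edge leaves `S`, the states vanishing off `S` form an invariant subspace. -/
theorem exists_trajectory_of_closed {G : WeightedGraph M} {S : Set (Fin M)}
    (hS : ∀ i ∉ S, ∀ j ∈ S, ¬ G.Edge j i)
    {v : ∀ k, (Fin (ag k).n → ℝ) × (Fin (pr k).s → ℝ)} (hv : ∀ i ∉ S, v i = 0) :
    ∃ z : ℝ → ∀ k, (Fin (ag k).n → ℝ) × (Fin (pr k).s → ℝ), z 0 = v ∧
      (∀ t, HasDerivAt z (closedLoop ag pr G (z t)) t) ∧ ∀ t, ∀ i ∉ S, z t i = 0 := by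
  let V : Submodule ℝ (∀ k, (Fin (ag k).n → ℝ) × (Fin (pr k).s → ℝ)) :=
    { carrier := {w | ∀ i ∉ S, w i = 0}
      zero_mem' := fun i _ => rfl
      add_mem' := fun {a b} ha hb i hi => by rw [Pi.add_apply, ha i hi, hb i hi, add_zero]
      smul_mem' := fun c a ha i hi => by rw [Pi.smul_apply, ha i hi, smul_zero] }
  refine exists_hasDerivAt_linear_mem (closedLoop ag pr G) V (fun w hw i hi => ?_) hv
  have hw' : ∀ i ∉ S, w i = 0 := hw
  have h1 := networkSignal_eq_zero hS (v := fun j => (ag j).C *ᵥ (w j).1)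
    (fun j hj => by rw [hw' j hj, Prod.fst_zero, mulVec_zero]) hi
  have h2 := networkSignal_eq_zero hS (v := fun j => (pr j).N *ᵥ (w j).2)
    (fun j hj => by rw [hw' j hj, Prod.snd_zero, mulVec_zero]) hi
  simp only [closedLoop, LinearMap.coe_mk, AddHom.coe_mk, h1, h2, hw' i hi, Prod.fst_zero,
    Prod.snd_zero, mulVec_zero, add_zero]
  rfl

/-! ### Output and weak synchronization -/

/-- Output synchronization implies weak synchronization over the same graph. -/
theorem OutputSynchronization.weakSynchronization {G : WeightedGraph M}
    (h : OutputSynchronization ag pr G) : WeakSynchronization ag pr G := by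
  intro x ξ hx i
  have := tendsto_finsetSum Finset.univ fun j _ => (h x ξ hx i j).const_smul (G.a i j)
  simp only [smul_zero, Finset.sum_const_zero] at this
  exact this

/-- If the Laplacian of `y` tends to zero and the graph has a spanning tree with root `r`, then
`y - y r` is recovered from the Laplacian by inverting the Dirichlet operator with boundary
`{r}`. -/
theorem WeakSynchronization.outputSynchronization {G : WeightedGraph M}
    (hG : G.HasDirectedSpanningTree) (h : WeakSynchronization ag pr G) :
    OutputSynchronization ag pr G := by
  obtain ⟨T, r, hT⟩ := hG
  have hr : ∀ i, ∃ b ∈ ({r} : Set (Fin M)), G.Reaches b i := fun i =>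
    ⟨r, rfl, Relation.ReflTransGen.mono hT.subgraph _ _ (hT.reaches i)⟩
  have hinj := dirichlet_injective hr
  let D := LinearEquiv.ofInjectiveEndo (G.dirichlet {r}) hinj
  intro x ξ hx
  have key : ∀ (c : Fin p) (i : Fin M),
      Tendsto (fun t => output ag x t i c - output ag x t r c) atTop (𝓝 0) := by
    intro c i
    have hD : Tendsto (fun t => D (fun k => output ag x t k c - output ag x t r c)) atTop
        (𝓝 0) := by
      refine tendsto_pi_nhds.2 fun k => ?_
      by_cases hk : k ∈ ({r} : Set (Fin M))
      · refine tendsto_const_nhds.congr fun t => ?_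
        refine Eq.trans ?_ (dirichlet_apply_of_mem hk _).symm
        rw [Set.mem_singleton_iff.1 hk, sub_self, Pi.zero_apply]
      · refine (tendsto_pi_nhds.1 (h x ξ hx k) c).congr fun t => ?_
        refine Eq.trans ?_ (dirichlet_apply_of_notMem hk _).symm
        simp only [networkSignal_apply, laplacian, sub_sub_sub_cancel_right]
    have hcont : Continuous D.symm := D.symm.toLinearMap.continuous_of_finiteDimensional
    have := (hcont.tendsto 0).comp hD
    simp only [map_zero] at this
    refine (tendsto_pi_nhds.1 this i).congr fun t => ?_
    simp
  intro i j
  refine tendsto_pi_nhds.2 fun c => ?_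
  have := (key c i).sub (key c j)
  simpa using this

/-- The signals of a trajectory that vanishes off the nodes reached from a source `r` tend to
zero: divided by the positive harmonic function of `r`, it is a trajectory over the Doob
transform of `G` on these nodes, which has a directed spanning tree. -/
theorem tendsto_networkSignal_of_source {G : WeightedGraph M}
    (hsync : ∀ (m : ℕ) (σ : Fin m ↪ Fin M) (G' : WeightedGraph m), G'.HasDirectedSpanningTree →
      OutputSynchronization (fun k => ag (σ k)) (fun k => pr (σ k)) G')
    {r : Fin M} (hr : ∀ k, G.Reaches k r → G.Reaches r k)
    {x : ∀ i, ℝ → Fin (ag i).n → ℝ} {ξ : ∀ i, ℝ → Fin (pr i).s → ℝ}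
    (hx : IsTrajectory ag pr G x ξ) (hx0 : ∀ i, ¬ G.Reaches r i → ∀ t, x i t = 0)
    (hξ0 : ∀ i, ¬ G.Reaches r i → ∀ t, ξ i t = 0) (i : Fin M) :
    Tendsto (fun t => networkSignal G (output ag x t) i) atTop (𝓝 0) := by
  classical
  have hout0 : ∀ t i, ¬ G.Reaches r i → output ag x t i = 0 := fun t i hi => by
    rw [output, hx0 i hi, mulVec_zero]
  have hpout0 : ∀ t i, ¬ G.Reaches r i → protocolOutput pr ξ t i = 0 := fun t i hi => by
    rw [protocolOutput, hξ0 i hi, mulVec_zero]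
  by_cases hi : G.Reaches r i
  swap
  · refine tendsto_const_nhds.congr fun t => ?_
    exact (networkSignal_eq_zero (S := {j | G.Reaches r j})
      (fun i hi j hj e => hi (Relation.ReflTransGen.tail hj e)) (hout0 t) hi).symm
  obtain ⟨h, hpos, hzero, hharm⟩ := exists_harmonic_of_source hr
  let σ : Fin (Finset.univ.filter fun j => G.Reaches r j).card ↪ Fin M :=
    (Finset.orderEmbOfFin _ rfl).toEmbedding
  have hσ : ∀ j, G.Reaches r j ↔ j ∈ Set.range σ := fun j => by
    have : Set.range σ = _ :=
      Finset.range_orderEmbOfFin (Finset.univ.filter fun j => G.Reaches r j) rfl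
    rw [this]
    simp
  have hpos' : ∀ k, 0 < h (σ k) := fun k => hpos _ ((hσ _).2 ⟨k, rfl⟩)
  have hzero' : ∀ j ∉ Set.range σ, h j = 0 := fun j hj => hzero j fun h' => hj ((hσ j).1 h')
  have hharm' : ∀ k, G.laplacian h (σ k) = 0 := fun k => hharm _ ((hσ _).2 ⟨k, rfl⟩)
  have hsig : ∀ t k, networkSignal (G.doobTransform σ h hpos')
      (output (fun k => ag (σ k)) (fun k t => (h (σ k))⁻¹ • x (σ k) t) t) k
        = (h (σ k))⁻¹ • networkSignal G (output ag x t) (σ k) := fun t k => by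
    rw [← networkSignal_doobTransform hpos' hzero' hharm'
      (fun j hj => hout0 t j fun h' => hj ((hσ j).1 h'))]
    congr 1
    ext1 l
    simp only [output, mulVec_smul]
  have hpsig : ∀ t k, networkSignal (G.doobTransform σ h hpos')
      (protocolOutput (fun k => pr (σ k)) (fun k t => (h (σ k))⁻¹ • ξ (σ k) t) t) k
        = (h (σ k))⁻¹ • networkSignal G (protocolOutput pr ξ t) (σ k) := fun t k => by
    rw [← networkSignal_doobTransform hpos' hzero' hharm'
      (fun j hj => hpout0 t j fun h' => hj ((hσ j).1 h'))]
    congr 1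
    ext1 l
    simp only [protocolOutput, mulVec_smul]
  have htraj : IsTrajectory (fun k => ag (σ k)) (fun k => pr (σ k)) (G.doobTransform σ h hpos')
      (fun k t => (h (σ k))⁻¹ • x (σ k) t) (fun k t => (h (σ k))⁻¹ • ξ (σ k) t) := by
    constructor
    · intro k t
      refine ((hx.agent_dynamics (σ k) t).const_smul (h (σ k))⁻¹).congr_deriv ?_
      simp only [mulVec_smul, smul_add]
    · intro k t
      refine ((hx.protocol_dynamics (σ k) t).const_smul (h (σ k))⁻¹).congr_deriv ?_
      simp only [hsig, hpsig, mulVec_smul, smul_add]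
  obtain ⟨k, rfl⟩ := (hσ i).1 hi
  have hweak := ((hsync _ σ _ (doobTransform_hasDirectedSpanningTree hpos' hσ)).weakSynchronization
    _ _ htraj k).const_smul (h (σ k))
  rw [smul_zero] at hweak
  refine hweak.congr fun t => ?_
  rw [hsig, smul_inv_smul₀ (hpos' k).ne']

/-- A trajectory is the sum of the trajectories whose initial states are supported at single
nodes; each of these vanishes off the nodes reached from some source. -/
theorem weakSynchronization_of_forall_outputSynchronization
    (hsync : ∀ (m : ℕ) (σ : Fin m ↪ Fin M) (G' : WeightedGraph m), G'.HasDirectedSpanningTree →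
      OutputSynchronization (fun k => ag (σ k)) (fun k => pr (σ k)) G')
    (G : WeightedGraph M) : WeakSynchronization ag pr G := by
  classical
  intro x ξ hx
  let z : ℝ → ∀ k, (Fin (ag k).n → ℝ) × (Fin (pr k).s → ℝ) := fun t k => (x k t, ξ k t)
  have hz : ∀ t, HasDerivAt z (closedLoop ag pr G (z t)) t := isTrajectory_iff_hasDerivAt.1 hx
  have hex : ∀ i, ∃ w : ℝ → ∀ k, (Fin (ag k).n → ℝ) × (Fin (pr k).s → ℝ),
      w 0 = Pi.single i (z 0 i) ∧ (∀ t, HasDerivAt w (closedLoop ag pr G (w t)) t) ∧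
        ∀ t, ∀ j ∉ {j | G.Reaches i j}, w t j = 0 := fun i =>
    exists_trajectory_of_closed (S := {j | G.Reaches i j})
      (fun k hk j hj e => hk (Relation.ReflTransGen.tail hj e))
      (fun j hj => Pi.single_eq_of_ne (fun h => hj (by rw [h]; exact Relation.ReflTransGen.refl)) _)
  choose w hw0 hw hwS using hex
  have hsum : z = fun t => ∑ i, w i t := by
    refine hasDerivAt_linear_unique (closedLoop ag pr G) hz (fun t => ?_) ?_
    · rw [map_sum]
      exact HasDerivAt.fun_sum fun i _ => hw i t
    · simp only [hw0]
      exact (Finset.univ_sum_single (z 0)).symm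
  have hlim : ∀ i k, Tendsto (fun t => networkSignal G (output ag (fun j t => (w i t j).1) t) k)
      atTop (𝓝 0) := by
    intro i
    obtain ⟨r, hri, hr⟩ := G.exists_source_reaches i
    have h0 : ∀ j, ¬ G.Reaches r j → ∀ t, w i t j = 0 := fun j hj t =>
      hwS i t j fun h' => hj (Relation.ReflTransGen.trans hri h')
    exact tendsto_networkSignal_of_source hsync hr (isTrajectory_iff_hasDerivAt.2 (hw i))
      (fun j hj t => by rw [h0 j hj t, Prod.fst_zero])
      (fun j hj t => by rw [h0 j hj t, Prod.snd_zero])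
  intro k
  have htotal := tendsto_finsetSum Finset.univ fun i _ => hlim i k
  rw [Finset.sum_const_zero] at htotal
  refine htotal.congr fun t => ?_
  have hout : ∀ j, output ag x t j = ∑ i, output ag (fun j t => (w i t j).1) t j := by
    intro j
    have hj : x j t = ∑ i, (w i t j).1 := by
      have := congrArg (fun f => (f t j).1) hsum
      simpa only [z, Finset.sum_apply, Prod.fst_sum] using this
    simp only [output, hj, mulVec_sum]
  simp only [networkSignal, hout]
  rw [Finset.sum_comm]
  simp only [← Finset.sum_sub_distrib, Finset.smul_sum]

end ClosedLoop

end MAS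

theorem mainTheorem2 {ι : Type*} {p q : ℕ} (ag : ι → MAS.Agent p)
    (pr : ∀ i, MAS.Protocol (ag i) q) :
    MAS.ScaleFreeOutputSynchronization ag pr ↔ MAS.ScaleFreeWeakSynchronization ag pr := by
  constructor
  · intro h M τ G
    exact MAS.weakSynchronization_of_forall_outputSynchronization
      (fun m σ G' hG' => h m (σ.trans τ) G' hG') G
  · intro h M τ G hG
    exact (h M τ G).outputSynchronization hG
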